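/- Let $\mathsf Y,\mathsf U$ be standard Borel spaces and $(\Theta,\rho)$ a metric space with its Borel $\sigma$-algebra. For every $\theta\in\Theta$ let a system be given by stochastic kernels $P_{\theta,t}=P_\theta(dy_t\mid y^{t-1},u^{t-1})$, $t\ge 1$, and let a controller $\gamma$ be given by stochastic kernels $Q_\gamma(du_t\mid y^t,u^{t-1})$, $t\ge 1$. Let $\Pi_{\theta,\gamma}$ be the joint law of $Y_1,U_1,Y_2,U_2,\dots$ in which $Y_t\sim P_\theta(\cdot\mid Y^{t-1},U^{t-1})$ and $U_t\sim Q_\gamma(\cdot\mid Y^t,U^{t-1})$ conditionally on the past, and write $\mathbb E_{\theta,\gamma}$ for its expectation. A $t$-step identification algorithm is a measurable map $\hat\theta_t:\mathsf Y^t\times\mathsf U^t\to\Theta$. For $\Lambda\subseteq\Theta$ let $$e_T(\Lambda,\gamma)=\inf_{\hat\theta_T}\sup_{\theta\in\Lambda}\mathbb E_{\theta,\gamma}\,\rho\big(\hat\theta_T(Y^T,U^T),\theta\big)\in[0,\infty],$$ where the infimum is over all $T$-step identification algorithms; let $N_\rho(\varepsilon;\Lambda)$ be the largest $N\ge1$ for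 which there are $\theta_1,\dots,\theta_N\in\Lambda$ with $\rho(\theta_i,\theta_j)\ge\varepsilon$ for all $i\ne j$ ($\infty$ if there is no largest one), and let $H_\rho(\varepsilon;\Lambda)=\log N_\rho(\varepsilon;\Lambda)$ (natural logarithm, with $\log\infty=\infty$, and $H_\rho=-\infty$ if $\Lambda$ is empty). Let $D(\cdot\|\cdot)\in[0,\infty]$ be the Kullback–Leibler divergence, in nats. Let $\Lambda\subseteq\Theta$, let $\gamma$ be a controller, $T\ge 0$ an integer, and $\delta_1,\dots,\delta_T\ge 0$ real numbers. Suppose that there are $t$-step identification algorithms $\hat\theta_t$, $t=0,\dots,T-1$, such that for every $t=1,\dots,T$ the predicted one-step law $P_{\hat\theta_{t-1}(y^{t-1},u^{t-1})}(dy_t\mid y^{t-1},u^{t-1})$ is a measurable function of $(y^{t-1},u^{t-1})$ and $$\sup_{\theta\in\Lambda}\mathbb E_{\theta,\gamma}\,D\big(P_{\theta,t}\,\big\|\,P_{\hat\theta_{t-1},t}\big)\le\delta_t .$$ Then every real number $\sigma_T$ with $$H_\rho(\sigma_T;\Lambda)\ \ge\ \Big\lceil 2\Big(\sum_{t=1}^T\delta_t+\log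 2\Big)\Big\rceil$$ satisfies $$e_T(\Lambda,\gamma)\ \ge\ \frac{\sigma_T}{4}.$$ -/

import Mathlib

open MeasureTheory ProbabilityTheory InformationTheory
open scoped ENNReal NNReal

namespace StochasticID

/-- The space `Y^t × U^t` of input-output trajectories `(y_1,…,y_t, u_1,…,u_t)` of length `t`. -/
abbrev History (Y U : Type*) (t : ℕ) : Type _ := (Fin t → Y) × (Fin t → U)

section System

variable {Y U : Type*} [MeasurableSpace Y] [MeasurableSpace U]

/-- A causal stochastic system: `kernel t` is the conditional law `P(dy_{t+1} | y^t, u^t)` of the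
output number `t + 1` given the first `t` outputs and inputs. -/
structure StochasticSystem (Y U : Type*) [MeasurableSpace Y] [MeasurableSpace U] where
  kernel : (t : ℕ) → Kernel (History Y U t) Y
  isMarkovKernel : ∀ t, IsMarkovKernel (kernel t)

/-- A controller: `kernel t` is the conditional law `Q(du_{t+1} | y^{t+1}, u^t)` of the input
number `t + 1` given the first `t + 1` outputs and the first `t` inputs. -/
structure Controller (Y U : Type*) [MeasurableSpace Y] [MeasurableSpace U] where
  kernel : (t : ℕ) → Kernel ((Fin (t + 1) → Y) × (Fin t → U)) U
  isMarkovKernel : ∀ t, IsMarkovKernel (kernel t)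

instance (S : StochasticSystem Y U) (t : ℕ) : IsMarkovKernel (S.kernel t) := S.isMarkovKernel t

instance (C : Controller Y U) (t : ℕ) : IsMarkovKernel (C.kernel t) := C.isMarkovKernel t

/-- Append a new output: `((y^t, u^t), y_{t+1}) ↦ (y^{t+1}, u^t)`. -/
def appendOutput {t : ℕ} (x : History Y U t × Y) : (Fin (t + 1) → Y) × (Fin t → U) :=
  (Fin.snoc (α := fun _ => Y) x.1.1 x.2, x.1.2)

/-- Append a new output and then a new input:
`(((y^t, u^t), y_{t+1}), u_{t+1}) ↦ (y^{t+1}, u^{t+1})`. -/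
def appendOutputInput {t : ℕ} (x : (History Y U t × Y) × U) : History Y U (t + 1) :=
  (Fin.snoc (α := fun _ => Y) x.1.1.1 x.1.2, Fin.snoc (α := fun _ => U) x.1.1.2 x.2)

theorem measurable_snoc_comp {A X : Type*} [MeasurableSpace A] [MeasurableSpace X] {t : ℕ}
    {f : A → Fin t → X} {g : A → X} (hf : Measurable f) (hg : Measurable g) :
    Measurable (fun a => (Fin.snoc (α := fun _ => X) (f a) (g a) : Fin (t + 1) → X)) := by
  refine measurable_pi_lambda _ fun i => ?_
  refine Fin.lastCases ?_ (fun j => ?_) i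
  · simpa using hg
  · simp only [Fin.snoc_castSucc]
    exact (measurable_pi_apply j).comp hf

theorem measurable_appendOutput {t : ℕ} :
    Measurable (appendOutput : History Y U t × Y → (Fin (t + 1) → Y) × (Fin t → U)) :=
  (measurable_snoc_comp (by fun_prop) (by fun_prop)).prodMk (by fun_prop)

theorem measurable_appendOutputInput {t : ℕ} :
    Measurable (appendOutputInput : (History Y U t × Y) × U → History Y U (t + 1)) :=
  (measurable_snoc_comp (by fun_prop) (by fun_prop)).prodMk
    (measurable_snoc_comp (by fun_prop) (by fun_prop))

/-- The law of `(Y^t, U^t)` when the system `S` is interconnected with the controller `C`.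
At each step the output is drawn from the system kernel given the past, and then the input is
drawn from the controller kernel given the past and the new output. -/
noncomputable def closedLoopLaw (S : StochasticSystem Y U) (C : Controller Y U) :
    (t : ℕ) → Measure (History Y U t)
  | 0 => Measure.dirac (Fin.elim0, Fin.elim0)
  | t + 1 =>
    ((closedLoopLaw S C t ⊗ₘ S.kernel t) ⊗ₘ
      (C.kernel t).comap appendOutput measurable_appendOutput).map appendOutputInput

instance isProbabilityMeasure_closedLoopLaw (S : StochasticSystem Y U) (C : Controller Y U) :
    (t : ℕ) → IsProbabilityMeasure (closedLoopLaw S C t)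
  | 0 => by unfold closedLoopLaw; infer_instance
  | t + 1 => by
    have := isProbabilityMeasure_closedLoopLaw S C t
    unfold closedLoopLaw
    exact Measure.isProbabilityMeasure_map measurable_appendOutputInput.aemeasurable

/-- The `T`-step minimax identification error on `Λ` relative to the controller `C`, where the
parameter `θ` describes the system `P θ`: the infimum over all measurable
`θhat : Y^T × U^T → Θ` of the worst-case expected distance between `θhat (Y^T, U^T)` and `θ`. -/
noncomputable def minimaxError {Θ : Type*} [MetricSpace Θ] [MeasurableSpace Θ]
    (P : Θ → StochasticSystem Y U) (C : Controller Y U) (Λ : Set Θ) (T : ℕ) : ℝ≥0∞ :=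
  ⨅ (θhat : History Y U T → Θ) (_ : Measurable θhat),
    ⨆ θ ∈ Λ, ∫⁻ z, ENNReal.ofReal (dist (θhat z) θ) ∂(closedLoopLaw (P θ) C T)

end System

/-- The packing number `N(ε; Λ)`: the largest `N ≥ 1` such that there are `θ_1, …, θ_N` in `Λ`
with pairwise distances at least `ε` (and `⊤` if there is no largest one). -/
noncomputable def packingNumber {Θ : Type*} [MetricSpace Θ] (ε : ℝ) (Λ : Set Θ) : ℕ∞ :=
  ⨆ (N : ℕ) (_ : 1 ≤ N ∧ ∃ θ : Fin N → Θ, (∀ i, θ i ∈ Λ) ∧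
    ∀ i j, i ≠ j → ε ≤ dist (θ i) (θ j)), (N : ℕ∞)

/-- The Kolmogorov entropy `H(ε; Λ) = log N(ε; Λ)` (natural logarithm). -/
noncomputable def kolmogorovEntropy {Θ : Type*} [MetricSpace Θ] (ε : ℝ) (Λ : Set Θ) : EReal :=
  ENNReal.log ((packingNumber ε Λ : ℕ∞) : ℝ≥0∞)

end StochasticID

/-! This is Fano's method with one common reference law: the closed loop whose outputs follow the
predicted kernels. It does not depend on `θ`, and each `θ ∈ Λ` has divergence at most `∑ δ t` from
it: outputs cost `δ t`, inputs nothing because the controller is the same. The entropy hypothesis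
gives `N` separated parameters with `2 (∑ δ t + log 2) ≤ log N`. By Fano, balls of radius `σ / 2`
around them catch the estimate with average probability at most `1 / 2`, so the average error is at
least `σ / 4`. Divergence of joint laws enters only as the inequality `EntropyBound` for bounded
test functions, which passes through kernels (`EntropyBound.compProd`) without densities. -/

namespace StochasticID

/-! ### Donsker–Varadhan bounds and Fano's inequality -/

section Variational

variable {A B : Type*} [MeasurableSpace A] [MeasurableSpace B]

theorem integrable_of_abs_le {μ : Measure A} [IsFiniteMeasure μ] {f : A → ℝ}
    (hf : Measurable f) {c : ℝ} (hc : ∀ x, |f x| ≤ c) : Integrable f μ :=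
  Integrable.of_bound hf.aestronglyMeasurable c
    (.of_forall fun x => (Real.norm_eq_abs (f x)).trans_le (hc x))

theorem integrable_exp_of_abs_le {μ : Measure A} [IsFiniteMeasure μ] {f : A → ℝ}
    (hf : Measurable f) {c : ℝ} (hc : ∀ x, |f x| ≤ c) :
    Integrable (fun x => Real.exp (f x)) μ := by
  refine integrable_of_abs_le hf.exp (c := Real.exp c) fun x => ?_
  rw [abs_of_pos (Real.exp_pos _)]
  exact Real.exp_le_exp.2 (le_of_abs_le (hc x))

theorem abs_integral_le_of_abs_le {μ : Measure A} [IsProbabilityMeasure μ] {f : A → ℝ} {c : ℝ}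
    (hc : ∀ x, |f x| ≤ c) : |∫ x, f x ∂μ| ≤ c := by
  simpa using norm_integral_le_of_norm_le_const (μ := μ) (f := f) (C := c)
    (.of_forall fun x => (Real.norm_eq_abs (f x)).trans_le (hc x))

theorem exp_neg_le_integral_exp {μ : Measure A} [IsProbabilityMeasure μ] {f : A → ℝ}
    (hf : Measurable f) {c : ℝ} (hc : ∀ x, |f x| ≤ c) :
    Real.exp (-c) ≤ ∫ x, Real.exp (f x) ∂μ := by
  have := integral_mono (μ := μ) (integrable_const (Real.exp (-c)))
    (integrable_exp_of_abs_le hf hc) fun x => Real.exp_le_exp.2 (neg_le_of_abs_le (hc x))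
  simpa using this

theorem integral_exp_le_exp {μ : Measure A} [IsProbabilityMeasure μ] {f : A → ℝ}
    (hf : Measurable f) {c : ℝ} (hc : ∀ x, |f x| ≤ c) :
    ∫ x, Real.exp (f x) ∂μ ≤ Real.exp c := by
  have := integral_mono (μ := μ) (integrable_exp_of_abs_le hf hc)
    (integrable_const (Real.exp c)) fun x => Real.exp_le_exp.2 (le_of_abs_le (hc x))
  simpa using this

theorem integral_exp_pos_of_abs_le {μ : Measure A} [IsProbabilityMeasure μ] {f : A → ℝ}
    (hf : Measurable f) {c : ℝ} (hc : ∀ x, |f x| ≤ c) : 0 < ∫ x, Real.exp (f x) ∂μ :=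
  (Real.exp_pos _).trans_le (exp_neg_le_integral_exp hf hc)

theorem abs_log_integral_exp_le {μ : Measure A} [IsProbabilityMeasure μ] {f : A → ℝ}
    (hf : Measurable f) {c : ℝ} (hc : ∀ x, |f x| ≤ c) :
    |Real.log (∫ x, Real.exp (f x) ∂μ)| ≤ c := by
  rw [abs_le]
  constructor
  · exact (Real.le_log_iff_exp_le (integral_exp_pos_of_abs_le hf hc)).2
      (exp_neg_le_integral_exp hf hc)
  · exact (Real.log_le_iff_le_exp (integral_exp_pos_of_abs_le hf hc)).2 (integral_exp_le_exp hf hc)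

/-- The easy half of the Donsker–Varadhan variational formula. -/
theorem ofReal_integral_sub_log_integral_exp_le_klDiv (μ ν : Measure A) [IsProbabilityMeasure μ]
    [IsProbabilityMeasure ν] {f : A → ℝ} (hf : Measurable f) {c : ℝ} (hc : ∀ x, |f x| ≤ c) :
    ENNReal.ofReal (∫ x, f x ∂μ - Real.log (∫ x, Real.exp (f x) ∂ν)) ≤ klDiv μ ν := by
  by_cases htop : klDiv μ ν = ∞
  · simp [htop]
  obtain ⟨hac, hint⟩ := klDiv_ne_top_iff.1 htop
  have hfμ : Integrable f μ := integrable_of_abs_le hf hc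
  have hfν := integrable_exp_of_abs_le (μ := ν) hf hc
  have : IsProbabilityMeasure (ν.tilted f) := isProbabilityMeasure_tilted hfν
  -- Gibbs' inequality for `μ` against the tilted measure.
  have h0 := integral_llr_add_sub_measure_univ_nonneg
    (hac.trans (absolutelyContinuous_tilted hfν)) (integrable_llr_tilted_right hac hfμ hint hfν)
  rw [integral_llr_tilted_right hac hfμ hfν hint] at h0
  rw [klDiv_of_ac_of_integrable hac hint]
  simp only [probReal_univ] at h0 ⊢
  exact ENNReal.ofReal_le_ofReal (by linarith)

/-- `μ` satisfies the Donsker–Varadhan inequality relative to `ν` with divergence budget `K`. -/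
def EntropyBound (μ ν : Measure A) (K : ℝ) : Prop :=
  ∀ f : A → ℝ, Measurable f → ∀ c : ℝ, (∀ x, |f x| ≤ c) →
    ∫ x, f x ∂μ ≤ K + Real.log (∫ x, Real.exp (f x) ∂ν)

theorem EntropyBound.map {μ ν : Measure A} {K : ℝ} (h : EntropyBound μ ν K) {g : A → B}
    (hg : Measurable g) : EntropyBound (μ.map g) (ν.map g) K := by
  intro f hf c hc
  rw [integral_map hg.aemeasurable hf.aestronglyMeasurable,
    integral_map hg.aemeasurable hf.exp.aestronglyMeasurable]
  exact h _ (hf.comp hg) c fun x => hc _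

/-- Chain rule: the fibrewise inequality replaces `f` by `g x = log ∫ exp (f (x, ·)) d(η x)`, again
bounded by `c`, and `exp ∘ g` has the same `ν`-integral as `exp ∘ f` under `ν ⊗ₘ η`. -/
theorem EntropyBound.compProd {μ ν : Measure A} [IsProbabilityMeasure μ] [IsProbabilityMeasure ν]
    {K : ℝ} (h : EntropyBound μ ν K) (κ η : Kernel A B) [IsMarkovKernel κ] [IsMarkovKernel η]
    {L : ℝ≥0} (hL : ∫⁻ x, klDiv (κ x) (η x) ∂μ ≤ L) :
    EntropyBound (μ ⊗ₘ κ) (ν ⊗ₘ η) (K + L) := by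
  intro f hf c hc
  rw [Measure.integral_compProd (integrable_of_abs_le hf hc),
    Measure.integral_compProd (integrable_exp_of_abs_le hf hc)]
  have hfx (x : A) : Measurable fun y => f (x, y) := hf.comp measurable_prodMk_left
  have hcx (x : A) (y : B) : |f (x, y)| ≤ c := hc _
  set m : A → ℝ := fun x => ∫ y, f (x, y) ∂(κ x)
  set g : A → ℝ := fun x => Real.log (∫ y, Real.exp (f (x, y)) ∂(η x))
  have hm : Measurable m :=
    (hf.stronglyMeasurable.integral_kernel_prod_right' (κ := κ)).measurable
  have hg : Measurable g :=
    (hf.exp.stronglyMeasurable.integral_kernel_prod_right' (κ := η)).measurable.log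
  have hmc (x : A) : |m x| ≤ c := abs_integral_le_of_abs_le (hcx x)
  have hgc (x : A) : |g x| ≤ c := abs_log_integral_exp_le (hfx x) (hcx x)
  have hmi : Integrable m μ := integrable_of_abs_le hm hmc
  have hgi : Integrable g μ := integrable_of_abs_le hg hgc
  have hexp : ∀ x, Real.exp (g x) = ∫ y, Real.exp (f (x, y)) ∂(η x) := fun x =>
    Real.exp_log (integral_exp_pos_of_abs_le (hfx x) (hcx x))
  have hstep : ∫ x, (m x - g x) ∂μ ≤ L := by
    have hle : ∫⁻ x, ENNReal.ofReal (m x - g x) ∂μ ≤ L :=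
      (lintegral_mono fun x => ofReal_integral_sub_log_integral_exp_le_klDiv (κ x) (η x)
        (hfx x) (hcx x)).trans hL
    calc ∫ x, (m x - g x) ∂μ ≤ (∫⁻ x, ENNReal.ofReal (m x - g x) ∂μ).toReal := by
          have := integral_eq_lintegral_pos_part_sub_lintegral_neg_part (hmi.sub hgi)
          simp only [Pi.sub_apply] at this
          linarith [ENNReal.toReal_nonneg (a := ∫⁻ x, ENNReal.ofReal (-(m x - g x)) ∂μ)]
      _ ≤ L := by simpa using ENNReal.toReal_mono ENNReal.coe_ne_top hle
  rw [integral_sub hmi hgi] at hstep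
  have hind := h g hg c hgc
  simp only [hexp] at hind
  linarith

theorem EntropyBound.compProd_self {μ ν : Measure A} [IsProbabilityMeasure μ]
    [IsProbabilityMeasure ν] {K : ℝ} (h : EntropyBound μ ν K) (κ : Kernel A B) [IsMarkovKernel κ] :
    EntropyBound (μ ⊗ₘ κ) (ν ⊗ₘ κ) K := by
  simpa using h.compProd κ κ (L := 0) (by simp)

/-- Testing the variational inequality on `log N` times an indicator, with the logarithm
bounded by its tangent at `2`. -/
theorem EntropyBound.mul_log_le {μ ν : Measure A} [IsProbabilityMeasure μ]
    [IsProbabilityMeasure ν] {K : ℝ} (h : EntropyBound μ ν K) {s : Set A} (hs : MeasurableSet s)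
    {N : ℝ} (hN : 1 ≤ N) :
    μ.real s * Real.log N ≤ K + Real.log 2 + ((1 + (N - 1) * ν.real s) / 2 - 1) := by
  have hlog : 0 ≤ Real.log N := Real.log_nonneg hN
  have h1 := h (s.indicator fun _ => Real.log N) (measurable_const.indicator hs) (Real.log N)
    fun x => by
      by_cases hx : x ∈ s <;> simp [hx, hlog, abs_of_nonneg]
  have h2 : (fun x => Real.exp (s.indicator (fun _ => Real.log N) x)) =
      fun x => 1 + s.indicator (fun _ => N - 1) x := by
    funext x
    by_cases hx : x ∈ s <;> simp [hx, Real.exp_log (by linarith : 0 < N)]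
  rw [h2, integral_add (integrable_const _) ((integrable_const _).indicator hs),
    integral_indicator_const _ hs, integral_indicator_const _ hs] at h1
  simp only [integral_const, probReal_univ, smul_eq_mul, mul_one] at h1
  have hpos : 0 < 1 + ν.real s * (N - 1) := by
    have := mul_nonneg (measureReal_nonneg (μ := ν) (s := s)) (sub_nonneg.2 hN)
    linarith
  -- The tangent bound is affine in `ν.real s`, so it can be summed over regions. The point `2`
  -- produces the `log 2` of Fano.
  have h3 := Real.log_le_sub_one_of_pos (div_pos hpos two_pos)
  rw [Real.log_div hpos.ne' two_ne_zero] at h3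
  linarith

/-- Fano's inequality for a family of disjoint decision regions. -/
theorem sum_measureReal_mul_log_le {N : ℕ} (hN : 1 ≤ N) {μ : Fin N → Measure A} {ν : Measure A}
    [∀ i, IsProbabilityMeasure (μ i)] [IsProbabilityMeasure ν] {K : ℝ}
    (h : ∀ i, EntropyBound (μ i) ν K) {s : Fin N → Set A} (hs : ∀ i, MeasurableSet (s i))
    (hdisj : Pairwise (Function.onFun Disjoint s)) :
    (∑ i, (μ i).real (s i)) * Real.log N ≤ N * (K + Real.log 2) := by
  have hN' : (1 : ℝ) ≤ N := by exact_mod_cast hN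
  have hν : ∑ i, ν.real (s i) ≤ 1 := by
    rw [← measureReal_iUnion_fintype hdisj hs]
    exact measureReal_le_one
  have hsum := Finset.sum_le_sum fun i (_ : i ∈ Finset.univ) => (h i).mul_log_le (hs i) hN'
  rw [← Finset.sum_mul] at hsum
  refine hsum.trans ?_
  have : ∑ i, (K + Real.log 2 + ((1 + ((N : ℝ) - 1) * ν.real (s i)) / 2 - 1)) =
      N * (K + Real.log 2) + ((N : ℝ) - 1) / 2 * ∑ i, ν.real (s i) - N / 2 := by
    rw [Finset.mul_sum]
    have (i : Fin N) : K + Real.log 2 + ((1 + ((N : ℝ) - 1) * ν.real (s i)) / 2 - 1) =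
        (K + Real.log 2 - 1 / 2) + ((N : ℝ) - 1) / 2 * ν.real (s i) := by ring
    simp only [this, Finset.sum_add_distrib, Finset.sum_const, Finset.card_univ, Fintype.card_fin,
      nsmul_eq_mul]
    ring
  rw [this]
  -- The tangent remainders total at most `(N - 1) / 2 - N / 2 < 0`.
  have := mul_le_mul_of_nonneg_left hν (by linarith : 0 ≤ ((N : ℝ) - 1) / 2)
  linarith

end Variational

/-! ### Extracting a finite packing from the entropy -/

section Packing

variable {Θ : Type*} [MetricSpace Θ]

theorem exists_packing_of_le_kolmogorovEntropy {ε x : ℝ} {Λ : Set Θ}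
    (h : (x : EReal) ≤ kolmogorovEntropy ε Λ) :
    ∃ N : ℕ, 1 ≤ N ∧ x ≤ Real.log N ∧ ∃ θ : Fin N → Θ, (∀ i, θ i ∈ Λ) ∧
      ∀ i j, i ≠ j → ε ≤ dist (θ i) (θ j) := by
  by_contra! hcon
  -- Integrality keeps the inequality strict in the supremum: every packing size is below `exp x`,
  -- hence at most `⌈exp x⌉₊ - 1`.
  have hlt : packingNumber ε Λ ≤ ((⌈Real.exp x⌉₊ - 1 : ℕ) : ℕ∞) := by
    refine iSup₂_le fun N hN => Nat.cast_le.2 ?_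
    obtain ⟨hN1, θ, hθ, hd⟩ := hN
    have hx : Real.log N < x := by
      by_contra! hx
      obtain ⟨i, j, hij, hlt⟩ := hcon N hN1 hx θ hθ
      exact absurd (hd i j hij) (not_le.2 hlt)
    have : (N : ℝ) < Real.exp x :=
      (Real.log_lt_iff_lt_exp (by exact_mod_cast hN1)).1 hx
    have := Nat.lt_ceil.2 this
    omega
  have hpos : 0 < ⌈Real.exp x⌉₊ := Nat.ceil_pos.2 (Real.exp_pos x)
  have h1 : ((packingNumber ε Λ : ℕ∞) : ℝ≥0∞) ≤ ((⌈Real.exp x⌉₊ - 1 : ℕ) : ℝ≥0∞) := by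
    simpa using ENat.toENNReal_mono hlt
  have h2 : ((⌈Real.exp x⌉₊ - 1 : ℕ) : ℝ≥0∞) < ENNReal.ofReal (Real.exp x) := by
    rw [← ENNReal.ofReal_natCast, ENNReal.ofReal_lt_ofReal_iff (Real.exp_pos x)]
    exact Nat.lt_ceil.1 (by omega)
  have h3 := ENNReal.log_lt_log (h1.trans_lt h2)
  rw [ENNReal.log_ofReal_of_pos (Real.exp_pos x), Real.log_exp] at h3
  exact absurd h (not_le.2 h3)

end Packing

/-! ### Divergence along the closed loop, and Markov's inequality -/

section ClosedLoop

variable {Y U Θ : Type*} [MeasurableSpace Y] [MeasurableSpace U]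

open Classical in
/-- The system which, up to time `T`, draws each output from the law predicted by `θhat`; after
time `T` it follows `S`. -/
noncomputable def predictorSystem (P : Θ → StochasticSystem Y U) (S : StochasticSystem Y U)
    (T : ℕ) (θhat : (t : ℕ) → History Y U t → Θ)
    (hP : ∀ t < T, Measurable fun z : History Y U t => (P (θhat t z)).kernel t z) :
    StochasticSystem Y U where
  kernel t := if h : t < T then ⟨fun z => (P (θhat t z)).kernel t z, hP t h⟩ else S.kernel t
  isMarkovKernel t := by
    split_ifs with h
    · exact ⟨fun z => inferInstanceAs (IsProbabilityMeasure ((P (θhat t z)).kernel t z))⟩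
    · infer_instance

theorem predictorSystem_kernel_apply (P : Θ → StochasticSystem Y U) (S : StochasticSystem Y U)
    {T : ℕ} (θhat : (t : ℕ) → History Y U t → Θ)
    (hP : ∀ t < T, Measurable fun z : History Y U t => (P (θhat t z)).kernel t z)
    {t : ℕ} (ht : t < T) (z : History Y U t) :
    (predictorSystem P S T θhat hP).kernel t z = (P (θhat t z)).kernel t z := by
  simp [predictorSystem, ht]

/-- One-step divergence bounds add up along the closed loop. -/
theorem entropyBound_closedLoopLaw (S R : StochasticSystem Y U) (C : Controller Y U)
    (δ : ℕ → ℝ≥0) (T : ℕ)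
    (h : ∀ t < T, ∫⁻ z, klDiv (S.kernel t z) (R.kernel t z) ∂(closedLoopLaw S C t) ≤ δ (t + 1)) :
    EntropyBound (closedLoopLaw S C T) (closedLoopLaw R C T)
      (∑ t ∈ Finset.Icc 1 T, (δ t : ℝ)) := by
  induction T with
  | zero =>
    intro f hf c _
    simp [closedLoopLaw, integral_dirac' _ _ hf.stronglyMeasurable,
      integral_dirac' _ _ hf.exp.stronglyMeasurable]
  | succ T ih =>
    rw [Finset.sum_Icc_succ_top (by omega)]
    exact (((ih fun t ht => h t (ht.trans T.lt_succ_self)).compProd _ _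
      (h T T.lt_succ_self)).compProd_self _).map measurable_appendOutputInput

variable [MetricSpace Θ] [MeasurableSpace Θ] [BorelSpace Θ]

theorem ofReal_mul_one_sub_le_lintegral_dist {A : Type*} [MeasurableSpace A] (μ : Measure A)
    [IsProbabilityMeasure μ] {g : A → Θ} (hg : Measurable g) (θ : Θ) (r : ℝ) :
    ENNReal.ofReal (r * (1 - μ.real {z | dist (g z) θ < r})) ≤
      ∫⁻ z, ENNReal.ofReal (dist (g z) θ) ∂μ := by
  have hs : MeasurableSet {z | dist (g z) θ < r} :=
    hg (Metric.isOpen_ball (x := θ) (ε := r)).measurableSet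
  rw [← probReal_compl_eq_one_sub hs]
  have hle : {z | dist (g z) θ < r}ᶜ ⊆ {z | ENNReal.ofReal r ≤ ENNReal.ofReal (dist (g z) θ)} :=
    fun z hz => ENNReal.ofReal_le_ofReal (not_lt.1 hz)
  calc ENNReal.ofReal (r * μ.real {z | dist (g z) θ < r}ᶜ)
      = ENNReal.ofReal r * μ {z | dist (g z) θ < r}ᶜ := by
        rw [ENNReal.ofReal_mul' measureReal_nonneg, ofReal_measureReal]
    _ ≤ ENNReal.ofReal r * μ {z | ENNReal.ofReal r ≤ ENNReal.ofReal (dist (g z) θ)} := by gcongr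
    _ ≤ _ := mul_meas_ge_le_lintegral₀
        (by
          have : Measurable fun z => dist (g z) θ :=
            (continuous_id.dist continuous_const).measurable.comp hg
          exact this.ennreal_ofReal.aemeasurable) _

end ClosedLoop

end StochasticID

theorem theorem2 {Y U Θ : Type*}
    [MeasurableSpace Y] [StandardBorelSpace Y] [MeasurableSpace U] [StandardBorelSpace U]
    [MetricSpace Θ] [MeasurableSpace Θ] [BorelSpace Θ]
    (P : Θ → StochasticID.StochasticSystem Y U) (γ : StochasticID.Controller Y U)
    (Λ : Set Θ) (T : ℕ) (δ : ℕ → ℝ≥0)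
    -- the identification algorithms for the times `0, …, T - 1`
    (θhat : (t : ℕ) → StochasticID.History Y U t → Θ)
    (hθhat : ∀ t < T, Measurable (θhat t))
    -- the predicted one-step kernels are stochastic kernels
    (hP : ∀ t < T, Measurable fun z : StochasticID.History Y U t =>
      (P (θhat t z)).kernel t z)
    (hδ : ∀ t < T,
      (⨆ θ ∈ Λ, ∫⁻ z, klDiv ((P θ).kernel t z) ((P (θhat t z)).kernel t z)
        ∂(StochasticID.closedLoopLaw (P θ) γ t)) ≤ (δ (t + 1) : ℝ≥0∞))
    (σ : ℝ)
    (hσ : (((⌈2 * (∑ t ∈ Finset.Icc 1 T, (δ t : ℝ) + Real.log 2)⌉ : ℤ) : ℝ) : EReal)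
      ≤ StochasticID.kolmogorovEntropy σ Λ) :
    ENNReal.ofReal (σ / 4) ≤ StochasticID.minimaxError P γ Λ T := by
  rcases le_or_gt σ 0 with hσ0 | hσ0
  · simp [ENNReal.ofReal_of_nonpos (by linarith : σ / 4 ≤ 0)]
  obtain ⟨N, hN1, hlogN, θ, hθ, hsep⟩ :=
    StochasticID.exists_packing_of_le_kolmogorovEntropy hσ
  set K : ℝ := ∑ t ∈ Finset.Icc 1 T, (δ t : ℝ)
  have hK : 0 ≤ K := Finset.sum_nonneg fun t _ => (δ t).2
  have hlog2 : 0 < Real.log 2 := Real.log_pos one_lt_two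
  have hlog : 2 * (K + Real.log 2) ≤ Real.log N := (Int.le_ceil _).trans hlogN
  have hN0 : (0 : ℝ) < N := by exact_mod_cast hN1
  -- The fallback system is arbitrary: its kernels act only after time `T`.
  let R := StochasticID.predictorSystem P (P (θ ⟨0, hN1⟩)) T θhat hP
  have hbound (i : Fin N) :
      StochasticID.EntropyBound (StochasticID.closedLoopLaw (P (θ i)) γ T)
        (StochasticID.closedLoopLaw R γ T) K := by
    refine StochasticID.entropyBound_closedLoopLaw _ _ _ _ _ fun t ht => ?_
    simp only [R, StochasticID.predictorSystem_kernel_apply _ _ _ _ ht]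
    exact (le_iSup₂_of_le (θ i) (hθ i) le_rfl).trans (hδ t ht)
  refine le_iInf₂ fun g hg => ?_
  set E := ⨆ θ ∈ Λ, ∫⁻ z, ENNReal.ofReal (dist (g z) θ)
    ∂(StochasticID.closedLoopLaw (P θ) γ T)
  by_cases hEtop : E = ∞
  · simp [hEtop]
  let s : Fin N → Set (StochasticID.History Y U T) := fun i => {z | dist (g z) (θ i) < σ / 2}
  have hs (i : Fin N) : MeasurableSet (s i) :=
    hg (Metric.isOpen_ball (x := θ i) (ε := σ / 2)).measurableSet
  have hdisj : Pairwise (Function.onFun Disjoint s) := by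
    intro i j hij
    refine Set.disjoint_left.2 fun z hi hj => ?_
    have hi' : dist (g z) (θ i) < σ / 2 := hi
    have hj' : dist (g z) (θ j) < σ / 2 := hj
    linarith [hsep i j hij, dist_triangle_left (θ i) (θ j) (g z)]
  have hfano := StochasticID.sum_measureReal_mul_log_le hN1 hbound hs hdisj
  set p : ℝ := ∑ i, (StochasticID.closedLoopLaw (P (θ i)) γ T).real (s i)
  -- Fano gives `p * log N ≤ N (K + log 2) ≤ (N / 2) log N`, and `log N > 0`.
  have hp : p ≤ N / 2 := by
    by_contra! hp
    have h1 := mul_lt_mul_of_pos_right hp (by linarith : 0 < Real.log N)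
    have h2 := mul_le_mul_of_nonneg_left hlog (by linarith : (0 : ℝ) ≤ N / 2)
    linarith
  have herr (i : Fin N) :
      σ / 2 * (1 - (StochasticID.closedLoopLaw (P (θ i)) γ T).real (s i)) ≤ E.toReal := by
    rw [← ENNReal.ofReal_le_iff_le_toReal hEtop]
    exact (StochasticID.ofReal_mul_one_sub_le_lintegral_dist _ hg _ _).trans
      (le_iSup₂_of_le (θ i) (hθ i) le_rfl)
  have hsum := Finset.sum_le_sum fun i (_ : i ∈ Finset.univ) => herr i
  rw [← Finset.mul_sum, Finset.sum_sub_distrib] at hsum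
  simp only [Finset.sum_const, Finset.card_univ, Fintype.card_fin, nsmul_eq_mul, mul_one] at hsum
  -- Worst case dominates average: at least half the total probability `N` is missed, at cost `σ /
  -- 2`.
  have h1 : σ / 2 * (N / 2) ≤ N * E.toReal :=
    (mul_le_mul_of_nonneg_left (by linarith : (N : ℝ) / 2 ≤ N - p) (by linarith)).trans hsum
  rw [ENNReal.ofReal_le_iff_le_toReal hEtop]
  refine le_of_mul_le_mul_left ?_ hN0
  linarith
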